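/- Let $k$ be a positive integer. A $k$-graph is a countable category $\Lambda$, with objects $\Lambda^0$ (vertices), morphisms also denoted $\Lambda$ (paths), range map $r$ and source map $s$ (so $\mu\nu$ is defined when $s(\mu)=r(\nu)$), together with a functor $d:\Lambda\to\mathbb{N}^k$ such that whenever $d(\lambda)=m+n$ with $m,n\in\mathbb{N}^k$ there are unique $\mu,\nu\in\Lambda$ with $s(\mu)=r(\nu)$, $d(\mu)=m$, $d(\nu)=n$ and $\lambda=\mu\nu$. The vertices are identified with the paths of degree $0$; put $v\Lambda=\{\lambda\in\Lambda: r(\lambda)=v\}$ and $v\Lambda^n=\{\lambda\in v\Lambda: d(\lambda)=n\}$. Assume that $\Lambda$ is row-finite with no sources, i.e. that $v\Lambda^n$ is finite and nonempty for all $v\in\Lambda^0$, $n\in\mathbb{N}^k$. Let $R$ be a commutative ring with $1$. The Kumjian-Pask algebra ${\rm KP}_R(\Lambda)$ is the universal (associative, not necessarily unital) $R$-algebra generated by elements $p_v$ ($v\in\Lambda^0$), $s_\lambda$ and $s_{\lambda^*}$ ($\lambda\in\Lambda$, $d(\lambda)\neq0$) subject to the following relations: (KP1) the $p_v$ are mutually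 orthogonal idempotents; (KP2) $s_\lambda s_\mu=s_{\lambda\mu}$, $s_{\mu^*}s_{\lambda^*}=s_{(\lambda\mu)^*}$, $p_{r(\lambda)}s_\lambda=s_\lambda=s_\lambda p_{s(\lambda)}$ and $p_{s(\lambda)}s_{\lambda^*}=s_{\lambda^*}=s_{\lambda^*}p_{r(\lambda)}$ for all $\lambda,\mu$ of nonzero degree with $r(\mu)=s(\lambda)$; (KP3) $s_{\lambda^*}s_\mu=\delta_{\lambda,\mu}\,p_{s(\lambda)}$ for all $\lambda,\mu$ of nonzero degree with $d(\lambda)=d(\mu)$; (KP4) $p_v=\sum_{\lambda\in v\Lambda^n}s_\lambda s_{\lambda^*}$ for all $v\in\Lambda^0$ and all nonzero $n\in\mathbb{N}^k$. For $v\in\Lambda^0$ put $s_v=s_{v^*}=p_v$. A pair $(\alpha,\beta)\in\Lambda\times\Lambda$ with $s(\alpha)=s(\beta)$ is called cycline if $s_{\alpha\gamma}s_{(\alpha\gamma)^*}=s_{\beta\gamma}s_{(\beta\gamma)^*}$ for all $\gamma\in s(\alpha)\Lambda$. The cycline subalgebra $\mathcal{M}$ is the (not necessarily unital) $R$-subalgebra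 of ${\rm KP}_R(\Lambda)$ generated by the elements $s_\alpha s_{\beta^*}$ with $(\alpha,\beta)$ cycline. **Theorem.** Let $A$ be a ring (not necessarily unital) and $\Phi:{\rm KP}_R(\Lambda)\to A$ a ring homomorphism (additive and multiplicative; not assumed $R$-linear). Then $\Phi$ is injective if and only if its restriction $\Phi|_{\mathcal{M}}$ is injective. -/

import Mathlib

open CategoryTheory

universe u v w

/-- A `k`-graph: a countable category `Λ` (objects are the vertices, morphisms are the paths) with a
degree functor to the one-object category `ℕ^k` that has the unique factorization property.

A path with source `v` and range `w` is a morphism `v ⟶ w`. The product `μν` of paths with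
`s(μ) = r(ν)` is the composite `μ ∘ ν`, which Mathlib writes `ν ≫ μ`. -/
class KGraph (k : ℕ) (Λ : Type u) [Category.{v} Λ] where
  countable_obj : Countable Λ
  countable_hom : ∀ a b : Λ, Countable (a ⟶ b)
  /-- The degree map `d`. -/
  degree : ∀ {a b : Λ}, (a ⟶ b) → (Fin k → ℕ)
  degree_id : ∀ a : Λ, degree (𝟙 a) = 0
  degree_comp : ∀ {a b c : Λ} (ν : a ⟶ b) (μ : b ⟶ c), degree (ν ≫ μ) = degree μ + degree ν
  /-- If `d(f) = m + n` then `f = μν` for unique paths `μ`, `ν` with `d(μ) = m` and `d(ν) = n`.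
  In the triple below, the first entry is the vertex `s(μ) = r(ν)`, the second is `ν`, the third
  is `μ`. -/
  factorization : ∀ {a b : Λ} (f : a ⟶ b) (m n : Fin k → ℕ), degree f = m + n →
    ∃! q : (Σ c : Λ, (a ⟶ c) × (c ⟶ b)),
      degree q.2.2 = m ∧ degree q.2.1 = n ∧ q.2.1 ≫ q.2.2 = f

namespace KGraph

/-- The type of all paths of `Λ`, with arbitrary source and range. -/
structure Path (Λ : Type u) [Category.{v} Λ] where
  {source : Λ}
  {range : Λ}
  hom : source ⟶ range

/-- The degree of a path. -/
def Path.deg (k : ℕ) {Λ : Type u} [Category.{v} Λ] [KGraph k Λ] (l : Path Λ) : Fin k → ℕ :=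
  KGraph.degree l.hom

/-- The set `aΛⁿ` of paths of degree `n` with range `a`. -/
def pathsTo {k : ℕ} {Λ : Type u} [Category.{v} Λ] [KGraph k Λ] (a : Λ) (n : Fin k → ℕ) :
    Set (Path Λ) :=
  {l | l.range = a ∧ l.deg k = n}

/-- `Λ` is row-finite: every `aΛⁿ` is finite. -/
def RowFinite (k : ℕ) (Λ : Type u) [Category.{v} Λ] [KGraph k Λ] : Prop :=
  ∀ (a : Λ) (n : Fin k → ℕ), (pathsTo a n).Finite

/-- `Λ` has no sources: every `aΛⁿ` is nonempty. -/
def NoSources (k : ℕ) (Λ : Type u) [Category.{v} Λ] [KGraph k Λ] : Prop :=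
  ∀ (a : Λ) (n : Fin k → ℕ), (pathsTo a n).Nonempty

/-- The generating symbols: vertices, paths of nonzero degree, and ghost paths of nonzero degree. -/
inductive Gen (k : ℕ) (Λ : Type u) [Category.{v} Λ] [KGraph k Λ]
  | vertex (a : Λ)
  | path (l : Path Λ) (hl : l.deg k ≠ 0)
  | ghost (l : Path Λ) (hl : l.deg k ≠ 0)

/-- The free (non-unital, associative) `R`-algebra on the generating symbols: the algebra of the
free semigroup of nonempty words. -/
abbrev FreeAlg (R : Type w) [CommRing R] (k : ℕ) (Λ : Type u) [Category.{v} Λ] [KGraph k Λ] :=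
  MonoidAlgebra R (FreeSemigroup (Gen k Λ))

section Free

variable (R : Type w) [CommRing R] (k : ℕ) {Λ : Type u} [Category.{v} Λ] [KGraph k Λ]

/-- A generating symbol as an element of the free algebra. -/
noncomputable def FreeAlg.of (g : Gen k Λ) : FreeAlg R k Λ :=
  MonoidAlgebra.single (FreeSemigroup.of g) 1

/-- The element `p_a` of the free algebra. -/
noncomputable def FreeAlg.p (a : Λ) : FreeAlg R k Λ := FreeAlg.of R k (Gen.vertex a)

open Classical in
/-- The element `s_l` of the free algebra, with the convention that `s_a = p_a` for a vertex `a`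
(the paths of degree `0` are the vertices). -/
noncomputable def FreeAlg.s (l : Path Λ) : FreeAlg R k Λ :=
  if h : l.deg k = 0 then FreeAlg.p R k l.range else FreeAlg.of R k (Gen.path l h)

open Classical in
/-- The element `s_{l^*}` of the free algebra, with the convention that `s_{a^*} = p_a` for a
vertex `a`. -/
noncomputable def FreeAlg.sStar (l : Path Λ) : FreeAlg R k Λ :=
  if h : l.deg k = 0 then FreeAlg.p R k l.range else FreeAlg.of R k (Gen.ghost l h)

open FreeAlg in
/-- The Kumjian-Pask relations: `KPRel R k x y` says that `x = y` is one of the relations. -/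
inductive KPRel : FreeAlg R k Λ → FreeAlg R k Λ → Prop
  /-- (KP1) the `p_a` are idempotent … -/
  | idem (a : Λ) : KPRel (p R k a * p R k a) (p R k a)
  /-- … and mutually orthogonal. -/
  | orth (a b : Λ) (hab : a ≠ b) : KPRel (p R k a * p R k b) 0
  /-- (KP2) `s_μ s_ν = s_{μν}`. -/
  | mul {a b c : Λ} (μ : b ⟶ c) (ν : a ⟶ b) (hμ : degree (k := k) μ ≠ 0)
      (hν : degree (k := k) ν ≠ 0) :
      KPRel (s R k ⟨μ⟩ * s R k ⟨ν⟩) (s R k ⟨ν ≫ μ⟩)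
  /-- (KP2) `s_{ν^*} s_{μ^*} = s_{(μν)^*}`. -/
  | mul_star {a b c : Λ} (μ : b ⟶ c) (ν : a ⟶ b) (hμ : degree (k := k) μ ≠ 0)
      (hν : degree (k := k) ν ≠ 0) :
      KPRel (sStar R k ⟨ν⟩ * sStar R k ⟨μ⟩) (sStar R k ⟨ν ≫ μ⟩)
  /-- (KP2) `p_{r(l)} s_l = s_l`. -/
  | range_mul (l : Path Λ) (hl : l.deg k ≠ 0) : KPRel (p R k l.range * s R k l) (s R k l)
  /-- (KP2) `s_l p_{s(l)} = s_l`. -/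
  | mul_source (l : Path Λ) (hl : l.deg k ≠ 0) : KPRel (s R k l * p R k l.source) (s R k l)
  /-- (KP2) `p_{s(l)} s_{l^*} = s_{l^*}`. -/
  | source_mul (l : Path Λ) (hl : l.deg k ≠ 0) :
      KPRel (p R k l.source * sStar R k l) (sStar R k l)
  /-- (KP2) `s_{l^*} p_{r(l)} = s_{l^*}`. -/
  | mul_range (l : Path Λ) (hl : l.deg k ≠ 0) : KPRel (sStar R k l * p R k l.range) (sStar R k l)
  /-- (KP3) `s_{l^*} s_l = p_{s(l)}`. -/
  | star_mul_self (l : Path Λ) (hl : l.deg k ≠ 0) : KPRel (sStar R k l * s R k l) (p R k l.source)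
  /-- (KP3) `s_{l^*} s_m = 0` for distinct paths `l`, `m` of the same degree. -/
  | star_mul_of_ne (l m : Path Λ) (hl : l.deg k ≠ 0) (hm : m.deg k ≠ 0) (hd : l.deg k = m.deg k)
      (hne : l ≠ m) : KPRel (sStar R k l * s R k m) 0
  /-- (KP4) `p_a = ∑_{l ∈ aΛⁿ} s_l s_{l^*}` for `n ≠ 0`. -/
  | sum (a : Λ) (n : Fin k → ℕ) (hn : n ≠ 0) (hfin : (pathsTo (k := k) a n).Finite) :
      KPRel (p R k a) (∑ l ∈ hfin.toFinset, s R k l * sStar R k l)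

variable (Λ)

/-- The two-sided `R`-algebra ideal of the free algebra generated by the Kumjian-Pask relations:
the smallest `R`-submodule that contains them and absorbs multiplication from either side. -/
noncomputable def kpIdeal : Submodule R (FreeAlg R k Λ) :=
  sInf {J | (∀ x y, KPRel R k x y → x - y ∈ J) ∧
    ∀ x y, y ∈ J → x * y ∈ J ∧ y * x ∈ J}

theorem mul_mem_kpIdeal (x : FreeAlg R k Λ) {y : FreeAlg R k Λ} (hy : y ∈ kpIdeal R k Λ) :
    x * y ∈ kpIdeal R k Λ ∧ y * x ∈ kpIdeal R k Λ := by
  simp only [kpIdeal, Submodule.mem_sInf] at hy ⊢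
  exact ⟨fun J hJ => (hJ.2 x y (hy J hJ)).1, fun J hJ => (hJ.2 x y (hy J hJ)).2⟩

end Free

/-- The Kumjian-Pask algebra `KP_R(Λ)`: the quotient of the free algebra by the Kumjian-Pask
relations. -/
noncomputable def KumjianPask (R : Type w) [CommRing R] (k : ℕ) (Λ : Type u) [Category.{v} Λ] [KGraph k Λ] :=
  FreeAlg R k Λ ⧸ kpIdeal R k Λ

namespace KumjianPask

variable (R : Type w) [CommRing R] (k : ℕ) {Λ : Type u} [Category.{v} Λ] [KGraph k Λ]

noncomputable instance : AddCommGroup (KumjianPask R k Λ) :=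
  inferInstanceAs (AddCommGroup (FreeAlg R k Λ ⧸ kpIdeal R k Λ))

noncomputable instance : Module R (KumjianPask R k Λ) :=
  inferInstanceAs (Module R (FreeAlg R k Λ ⧸ kpIdeal R k Λ))

/-- The quotient map from the free algebra. -/
noncomputable def mk : FreeAlg R k Λ →ₗ[R] KumjianPask R k Λ := (kpIdeal R k Λ).mkQ

theorem mk_surjective : Function.Surjective (mk R k (Λ := Λ)) :=
  (kpIdeal R k Λ).mkQ_surjective

theorem mk_eq_mk {x y : FreeAlg R k Λ} : mk R k x = mk R k y ↔ x - y ∈ kpIdeal R k Λ :=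
  Submodule.Quotient.eq _

noncomputable instance : Mul (KumjianPask R k Λ) where
  mul := Quotient.map₂ (· * ·) (by
    intro a b hab c d hcd
    have h1 : a - b ∈ kpIdeal R k Λ := (Submodule.quotientRel_def _).1 hab
    have h2 : c - d ∈ kpIdeal R k Λ := (Submodule.quotientRel_def _).1 hcd
    refine (Submodule.quotientRel_def _).2 ?_
    have h : a * c - b * d = (a - b) * c + b * (c - d) := by
      rw [sub_mul, mul_sub]; abel
    rw [h]
    exact add_mem (mul_mem_kpIdeal R k Λ c h1).2 (mul_mem_kpIdeal R k Λ b h2).1)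

theorem mk_mul (x y : FreeAlg R k Λ) : mk R k (x * y) = mk R k x * mk R k y := rfl

noncomputable instance : NonUnitalRing (KumjianPask R k Λ) where
  left_distrib a b c := by
    obtain ⟨a, rfl⟩ := mk_surjective R k a
    obtain ⟨b, rfl⟩ := mk_surjective R k b
    obtain ⟨c, rfl⟩ := mk_surjective R k c
    simp only [← mk_mul, ← map_add, mul_add]
  right_distrib a b c := by
    obtain ⟨a, rfl⟩ := mk_surjective R k a
    obtain ⟨b, rfl⟩ := mk_surjective R k b
    obtain ⟨c, rfl⟩ := mk_surjective R k c
    simp only [← mk_mul, ← map_add, add_mul]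
  zero_mul a := by
    obtain ⟨a, rfl⟩ := mk_surjective R k a
    rw [← map_zero (mk R k (Λ := Λ)), ← mk_mul, zero_mul]
  mul_zero a := by
    obtain ⟨a, rfl⟩ := mk_surjective R k a
    rw [← map_zero (mk R k (Λ := Λ)), ← mk_mul, mul_zero]
  mul_assoc a b c := by
    obtain ⟨a, rfl⟩ := mk_surjective R k a
    obtain ⟨b, rfl⟩ := mk_surjective R k b
    obtain ⟨c, rfl⟩ := mk_surjective R k c
    simp only [← mk_mul, mul_assoc]

instance : IsScalarTower R (KumjianPask R k Λ) (KumjianPask R k Λ) where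
  smul_assoc r a b := by
    obtain ⟨a, rfl⟩ := mk_surjective R k a
    obtain ⟨b, rfl⟩ := mk_surjective R k b
    simp only [smul_eq_mul, ← map_smul, ← mk_mul, smul_mul_assoc]

instance : SMulCommClass R (KumjianPask R k Λ) (KumjianPask R k Λ) where
  smul_comm r a b := by
    obtain ⟨a, rfl⟩ := mk_surjective R k a
    obtain ⟨b, rfl⟩ := mk_surjective R k b
    simp only [smul_eq_mul, ← map_smul, ← mk_mul, mul_smul_comm]

/-- The generator `p_a` of `KP_R(Λ)`. -/
noncomputable def p (a : Λ) : KumjianPask R k Λ := mk R k (FreeAlg.p R k a)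

/-- The generator `s_l` of `KP_R(Λ)`, for a path `l : a ⟶ b`; it is `p_a` if `l` is a vertex. -/
noncomputable def s {a b : Λ} (l : a ⟶ b) : KumjianPask R k Λ := mk R k (FreeAlg.s R k ⟨l⟩)

/-- The generator `s_{l^*}` of `KP_R(Λ)`, for a path `l : a ⟶ b`; it is `p_a` if `l` is a
vertex. -/
noncomputable def sStar {a b : Λ} (l : a ⟶ b) : KumjianPask R k Λ :=
  mk R k (FreeAlg.sStar R k ⟨l⟩)

/-- `(α, β)`, with `s(α) = s(β)`, is a cycline pair:
`s_{αγ} s_{(αγ)^*} = s_{βγ} s_{(βγ)^*}` for all paths `γ` with range `s(α)`. -/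
def IsCycline {a b c : Λ} (α : a ⟶ b) (β : a ⟶ c) : Prop :=
  ∀ (e : Λ) (γ : e ⟶ a),
    s R k (γ ≫ α) * sStar R k (γ ≫ α) = s R k (γ ≫ β) * sStar R k (γ ≫ β)

variable (Λ)

/-- The cycline subalgebra: the (non-unital) `R`-subalgebra of `KP_R(Λ)` generated by the elements
`s_α s_{β^*}` with `(α, β)` a cycline pair. -/
noncomputable def cyclineSubalgebra : NonUnitalSubalgebra R (KumjianPask R k Λ) :=
  NonUnitalAlgebra.adjoin R
    {x | ∃ (a b c : Λ) (α : a ⟶ b) (β : a ⟶ c), IsCycline R k α β ∧ x = s R k α * sStar R k β}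

end KumjianPask

end KGraph

/-! Write `αγ` for `γ ≫ α`. The kernel of `Φ` absorbs multiplication from both sides, so it suffices
to compress each nonzero `x` to a nonzero element `y x z` of the cycline subalgebra
(`exists_mul_mem_cyclineSubalgebra`).

For `β` of large degree, `x s_β` contains no ghost paths: it is a combination `∑ r_κ s_κ` of paths
with a common source (`exists_mul_s_mem_span`). Local units and (KP4) give such a `β` with `x s_β ≠
0` (`exists_mul_s_ne_zero`). Fix `α` with `r_α ≠ 0`. A single `γ` can be chosen such that, for each
`κ` in the support, either `s_{(αγ)^*} s_{κγ} = 0` or `(αγ, κγ)` is cycline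
(`exists_forall_eq_zero_or_isCycline`). Multiplying by `s_{αγ} s_{(αγ)^*}` on the left and by `s_γ
s_{(αγ)^*}` on the right leaves `∑ r_κ s_{κγ} s_{(αγ)^*}` over the cycline `κ`. This sum lies in the
cycline subalgebra.

It is nonzero because a further factor `s_{αγ}` on the right turns it into `∑ r_κ s_{κγ}`, in which
`r_α` occurs, and the `s_κ` with a common source are linearly independent (`linearIndependent_s`).
Independence is seen in a representation on infinite paths carrying a lag in `ℤ^k`; without the lag,
periodic paths could identify `αx` and `βx` for `α ≠ β`. -/

namespace KGraph

/-! ### Unique factorization and cancellation -/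

section Factorization

variable (k : ℕ) {Λ : Type u} [Category.{v} Λ] [KGraph k Λ]

theorem exists_comp_eq {a b : Λ} (f : a ⟶ b) {m : Fin k → ℕ} (hm : m ≤ degree (k := k) f) :
    ∃ (c : Λ) (ν : a ⟶ c) (μ : c ⟶ b), degree (k := k) μ = m ∧ ν ≫ μ = f := by
  obtain ⟨q, ⟨h1, -, h3⟩, -⟩ :=
    factorization f m (degree f - m) (add_tsub_cancel_of_le hm).symm
  exact ⟨q.1, q.2.1, q.2.2, h1, h3⟩

/-- Cancellation in `ℕ^k` makes the degrees of `ν` and `ν'` agree as well, so both pairs are the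
same factorization. The sigma type accommodates the a priori different middle vertices. -/
theorem sigma_eq_of_comp_eq {a b c c' : Λ} {ν : a ⟶ c} {μ : c ⟶ b} {ν' : a ⟶ c'} {μ' : c' ⟶ b}
    (h : ν ≫ μ = ν' ≫ μ') (hd : degree (k := k) μ = degree (k := k) μ') :
    (⟨c, ν, μ⟩ : Σ c : Λ, (a ⟶ c) × (c ⟶ b)) = ⟨c', ν', μ'⟩ := by
  have h1 := degree_comp (k := k) ν μ
  have h2 := degree_comp (k := k) ν' μ'
  have hν : degree (k := k) ν' = degree (k := k) ν := by
    rw [← h, h1, hd] at h2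
    exact (add_left_cancel h2).symm
  exact (factorization (ν ≫ μ) _ _ h1).unique ⟨rfl, rfl, rfl⟩ ⟨hd.symm, hν, h.symm⟩

theorem sigma_eq_id_of_degree_eq_zero {a b : Λ} (f : a ⟶ b) (hf : degree (k := k) f = 0) :
    (⟨b, f⟩ : Σ b : Λ, a ⟶ b) = ⟨a, 𝟙 a⟩ := by
  have := sigma_eq_of_comp_eq k (show 𝟙 a ≫ f = f ≫ 𝟙 b by simp) (by rw [hf, degree_id])
  simp only [Sigma.mk.injEq] at this
  obtain ⟨rfl, h⟩ := this
  simp only [heq_eq_eq, Prod.mk.injEq] at h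
  rw [h.2]

end Factorization

theorem comp_right_cancel (k : ℕ) {Λ : Type u} [Category.{v} Λ] [KGraph k Λ]
    {a b c : Λ} {ν ν' : a ⟶ c} {μ : c ⟶ b} (h : ν ≫ μ = ν' ≫ μ) :
    ν = ν' := by
  have := sigma_eq_of_comp_eq k h rfl
  simpa using this

theorem comp_left_cancel (k : ℕ) {Λ : Type u} [Category.{v} Λ] [KGraph k Λ]
    {a b c : Λ} {ν : a ⟶ c} {μ μ' : c ⟶ b} (h : ν ≫ μ = ν ≫ μ') :
    μ = μ' := by
  have h1 := degree_comp (k := k) ν μ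
  rw [h, degree_comp] at h1
  have := sigma_eq_of_comp_eq k h (add_right_cancel h1).symm
  simpa using this

/-! ### Infinite paths: prefixing, shifting, existence -/

/-- An infinite path with range `a`, given by the set of its finite initial segments. -/
@[ext]
structure InfPath (k : ℕ) {Λ : Type u} [Category.{v} Λ] [KGraph k Λ] (a : Λ) where
  seg : ∀ {c : Λ}, (c ⟶ a) → Prop
  of_comp : ∀ {b c : Λ} (ν : b ⟶ c) (μ : c ⟶ a), seg (ν ≫ μ) → seg μ
  exists_degree : ∀ n : Fin k → ℕ, ∃ (c : Λ) (μ : c ⟶ a), degree μ = n ∧ seg μ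
  directed : ∀ {b c : Λ} (μ : b ⟶ a) (μ' : c ⟶ a), seg μ → seg μ' →
    ∃ (e : Λ) (ν : e ⟶ b) (ν' : e ⟶ c), ν ≫ μ = ν' ≫ μ' ∧ seg (ν ≫ μ)

namespace InfPath

variable {k : ℕ} {Λ : Type u} [Category.{v} Λ] [KGraph k Λ]

/-- Two segments have a common prolongation, whose factorization at a given degree is unique. Hence
an infinite path has exactly one segment of each degree. -/
theorem sigma_eq {a b c : Λ} (x : InfPath k a) {μ : b ⟶ a} {μ' : c ⟶ a} (h : x.seg μ)
    (h' : x.seg μ') (hd : degree (k := k) μ = degree (k := k) μ') :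
    (⟨b, μ⟩ : Σ b : Λ, b ⟶ a) = ⟨c, μ'⟩ := by
  obtain ⟨e, ν, ν', h1, -⟩ := x.directed μ μ' h h'
  have := sigma_eq_of_comp_eq k h1 hd
  simp only [Sigma.mk.injEq] at this
  obtain ⟨rfl, h⟩ := this
  simp only [heq_eq_eq, Prod.mk.injEq] at h
  rw [h.2]

/-- The infinite path `αx`. -/
def act {a b : Λ} (α : a ⟶ b) (x : InfPath k a) : InfPath k b where
  seg {c} μ := ∃ (e : Λ) (ν : e ⟶ a) (η : e ⟶ c), x.seg ν ∧ η ≫ μ = ν ≫ α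
  of_comp := by
    rintro b c ν' μ ⟨e, ν, η, h, h'⟩
    exact ⟨e, ν, η ≫ ν', h, by simpa using h'⟩
  exists_degree n := by
    obtain ⟨c, ν, hν, hx⟩ := x.exists_degree n
    obtain ⟨e, η, μ, hμ, h⟩ := exists_comp_eq k (ν ≫ α) (m := n)
      (by rw [degree_comp, hν]; exact le_add_of_nonneg_left zero_le)
    exact ⟨e, μ, hμ, c, ν, η, hx, h⟩
  directed := by
    rintro b' c' μ μ' ⟨e, ν, η, h, h1⟩ ⟨e', ν', η', h', h1'⟩
    obtain ⟨f, ρ, ρ', h2, h3⟩ := x.directed ν ν' h h'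
    refine ⟨f, ρ ≫ η, ρ' ≫ η', ?_, f, ρ ≫ ν, 𝟙 f, h3, ?_⟩
    · rw [Category.assoc, Category.assoc, h1, h1', ← Category.assoc, h2, Category.assoc]
    · rw [Category.assoc, h1, Category.id_comp, Category.assoc]

theorem seg_comp_act_iff {a b c : Λ} (α : a ⟶ b) (x : InfPath k a) (ν : c ⟶ a) :
    (act α x).seg (ν ≫ α) ↔ x.seg ν := by
  constructor
  · rintro ⟨e, ν', η, h, h'⟩
    rw [← Category.assoc] at h'
    rw [← comp_right_cancel k h'] at h
    exact x.of_comp _ _ h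
  · exact fun h => ⟨c, ν, 𝟙 c, h, by simp⟩

theorem seg_id {a : Λ} (x : InfPath k a) : x.seg (𝟙 a) := by
  obtain ⟨c, μ, -, h⟩ := x.exists_degree 0
  exact x.of_comp μ _ (by simpa using h)

theorem seg_act {a b : Λ} (α : a ⟶ b) (x : InfPath k a) : (act α x).seg α := by
  simpa using (seg_comp_act_iff α x (𝟙 a)).2 x.seg_id

theorem act_injective {a b : Λ} (α : a ⟶ b) {x y : InfPath k a} (h : act α x = act α y) :
    x = y := by
  ext c ν
  rw [← seg_comp_act_iff α, h, seg_comp_act_iff]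

theorem act_id {a : Λ} (x : InfPath k a) : act (𝟙 a) x = x := by
  ext c μ
  rw [← seg_comp_act_iff (𝟙 a) x, Category.comp_id]

theorem act_comp {a b c : Λ} (ν : a ⟶ b) (μ : b ⟶ c) (x : InfPath k a) :
    act (ν ≫ μ) x = act μ (act ν x) := by
  ext d κ
  constructor
  · rintro ⟨e, ξ, η, h, h'⟩
    exact ⟨e, ξ ≫ ν, η, (seg_comp_act_iff ν x ξ).2 h, by simpa using h'⟩
  · rintro ⟨e, τ, η, ⟨f, ξ, η', h1, h2⟩, h3⟩
    exact ⟨f, ξ, η' ≫ η, h1, by rw [Category.assoc, h3, ← Category.assoc, h2, Category.assoc]⟩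

/-- The path `y` is the shift of `x`: its segments are the `ν` for which `αν` is a segment of `x`.
-/
theorem exists_act_eq {a b : Λ} (α : a ⟶ b) (x : InfPath k b) (hα : x.seg α) :
    ∃ y : InfPath k a, act α y = x := by
  refine ⟨⟨fun ν => x.seg (ν ≫ α), ?_, ?_, ?_⟩, ?_⟩
  · intro b c ν μ h
    exact x.of_comp ν _ (by simpa using h)
  · intro n
    -- A segment of degree `d(α) + n` must begin with `α`, the only segment of degree `d(α)`; its
    -- remainder has degree `n`.
    obtain ⟨c, μ, hμ, hx⟩ := x.exists_degree (degree α + n)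
    obtain ⟨e, ν, α', hd, rfl⟩ := exists_comp_eq k μ (m := degree α)
      (by rw [hμ]; exact le_add_of_nonneg_right zero_le)
    have := x.sigma_eq hα (x.of_comp _ _ hx) hd.symm
    simp only [Sigma.mk.injEq] at this
    obtain ⟨rfl, h⟩ := this
    simp only [heq_eq_eq] at h
    subst h
    refine ⟨c, ν, ?_, hx⟩
    rw [degree_comp] at hμ
    exact add_left_cancel hμ
  · intro b c μ μ' h h'
    obtain ⟨e, ν, ν', h1, h2⟩ := x.directed _ _ h h'
    refine ⟨e, ν, ν', comp_right_cancel k (μ := α) (by simpa using h1), by simpa using h2⟩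
  · ext c μ
    constructor
    · rintro ⟨e, ν, η, h, h'⟩
      exact x.of_comp η _ (by rw [h']; exact h)
    · intro h
      obtain ⟨e, ν, ν', h1, h2⟩ := x.directed _ _ h hα
      exact ⟨e, ν', ν, show x.seg (ν' ≫ α) by rw [← h1]; exact h2, h1⟩

/-- The finite paths obtained by successively prolonging the vertex `a`. -/
def prolong (e : ∀ a : Λ, Σ c : Λ, c ⟶ a) (a : Λ) : ℕ → Σ c : Λ, c ⟶ a
  | 0 => ⟨a, 𝟙 a⟩
  | j + 1 => ⟨(e (prolong e a j).1).1, (e (prolong e a j).1).2 ≫ (prolong e a j).2⟩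

theorem exists_comp_prolong (e : ∀ a : Λ, Σ c : Λ, c ⟶ a) (a : Λ) {i j : ℕ} (h : i ≤ j) :
    ∃ ρ, (prolong e a j).2 = ρ ≫ (prolong e a i).2 := by
  induction j, h using Nat.le_induction with
  | base => exact ⟨𝟙 _, by simp⟩
  | succ j _ ih =>
    obtain ⟨ρ, h⟩ := ih
    exact ⟨(e (prolong e a j).1).2 ≫ ρ, by simp [prolong, h]⟩

/-- Without sources, `a` can be prolonged forever by paths of degree `(1, …, 1)`; the initial
segments of the resulting chain form an infinite path. -/
theorem nonempty (hns : NoSources k Λ) (a : Λ) : Nonempty (InfPath k a) := by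
  have he : ∀ a : Λ, ∃ q : Σ c : Λ, c ⟶ a, degree (k := k) q.2 = 1 := by
    intro a
    obtain ⟨⟨l⟩, rfl, h⟩ := hns a 1
    exact ⟨⟨_, l⟩, h⟩
  choose e he using he
  have hdeg : ∀ j : ℕ, degree (k := k) (prolong e a j).2 = fun _ => j := by
    intro j
    induction j with
    | zero => exact degree_id a
    | succ j ih =>
      rw [prolong, degree_comp, ih, he]
      ext; simp
  refine ⟨⟨fun {c} μ => ∃ (j : ℕ) (η : (prolong e a j).1 ⟶ c), η ≫ μ = (prolong e a j).2,
    ?_, ?_, ?_⟩⟩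
  · rintro b c ν μ ⟨j, η, h⟩
    exact ⟨j, η ≫ ν, by simpa using h⟩
  -- The stage `j = ∑ n_i` works because `n ≤ (j, …, j)`.
  · intro n
    obtain ⟨c, η, μ, h, h'⟩ := exists_comp_eq k (prolong e a (∑ i, n i)).2 (m := n)
      (by rw [hdeg]; intro i; exact Finset.single_le_sum (fun _ _ => Nat.zero_le _)
            (Finset.mem_univ i))
    exact ⟨c, μ, h, _, η, h'⟩
  · rintro b c μ μ' ⟨j, η, h⟩ ⟨j', η', h'⟩
    obtain ⟨ρ, hρ⟩ := exists_comp_prolong e a (le_max_left j j')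
    obtain ⟨ρ', hρ'⟩ := exists_comp_prolong e a (le_max_right j j')
    refine ⟨_, ρ ≫ η, ρ' ≫ η', ?_, max j j', 𝟙 _, ?_⟩
    · rw [Category.assoc, Category.assoc, h, h', ← hρ, ← hρ']
    · rw [Category.assoc, h, ← hρ, Category.id_comp]

end InfPath

/-! ### The infinite path representation and linear independence -/

section Representation

open Classical in
/-- The endomorphism of the free module on `Y` that maps a basis vector `y` to the basis vector `z`
with `P y z`, and to `0` if there is none. -/
noncomputable def relOp (R : Type*) [CommRing R] {Y : Type*} (P : Y → Y → Prop) :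
    Module.End R (Y →₀ R) :=
  Finsupp.linearCombination R fun y => if h : ∃ z, P y z then Finsupp.single h.choose 1 else 0

variable {R : Type w} [CommRing R]

theorem relOp_single {Y : Type*} {P : Y → Y → Prop} (hP : ∀ y z z', P y z → P y z' → z = z')
    {y z : Y} (h : P y z) : relOp R P (Finsupp.single y 1) = Finsupp.single z 1 := by
  have hz : ∃ z, P y z := ⟨z, h⟩
  rw [relOp, Finsupp.linearCombination_single, dif_pos hz, one_smul, hP _ _ _ hz.choose_spec h]

theorem relOp_single_eq_zero {Y : Type*} {P : Y → Y → Prop} {y : Y} (h : ∀ z, ¬ P y z) :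
    relOp R P (Finsupp.single y 1) = 0 := by
  rw [relOp, Finsupp.linearCombination_single, dif_neg (by simpa using h), smul_zero]

variable (k : ℕ) (Λ : Type u) [Category.{v} Λ] [KGraph k Λ]

/-- Infinite paths with arbitrary range, together with a lag in `ℤ^k`. -/
abbrev LagPath := Σ a : Λ, InfPath k a × (Fin k → ℤ)

variable {k Λ}

/-- The relation `z = l y` between infinite paths with a lag. -/
inductive IsAct : Path Λ → LagPath k Λ → LagPath k Λ → Prop
  | mk {a b : Λ} (α : a ⟶ b) (x : InfPath k a) (n : Fin k → ℤ) :
      IsAct ⟨α⟩ ⟨a, x, n⟩ ⟨b, x.act α, n + fun i => (degree (k := k) α i : ℤ)⟩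

theorem IsAct.right_unique (l : Path Λ) (y z z' : LagPath k Λ) (h : IsAct l y z)
    (h' : IsAct l y z') : z = z' := by
  cases h; cases h'; rfl

theorem IsAct.left_unique (l : Path Λ) (z y y' : LagPath k Λ) (h : IsAct l y z)
    (h' : IsAct l y' z) : y = y' := by
  obtain ⟨α, x, n⟩ := h
  generalize hz : (⟨_, x.act α, n + _⟩ : LagPath k Λ) = z at h'
  generalize hl : Path.mk α = l at h'
  obtain ⟨α', x', n'⟩ := h'
  cases hl
  simp only [Sigma.mk.injEq, heq_eq_eq, Prod.mk.injEq, true_and, add_left_inj] at hz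
  rw [InfPath.act_injective α hz.1, hz.2]

theorem IsAct.range_eq {l : Path Λ} {y z : LagPath k Λ} (h : IsAct l y z) : z.1 = l.range := by
  cases h; rfl

theorem IsAct.source_eq {l : Path Λ} {y z : LagPath k Λ} (h : IsAct l y z) : y.1 = l.source := by
  cases h; rfl

theorem IsAct.exists_right (l : Path Λ) (y : LagPath k Λ) (h : y.1 = l.source) :
    ∃ z, IsAct l y z := by
  obtain ⟨a, x, n⟩ := y
  obtain ⟨α⟩ := l
  subst h
  exact ⟨_, ⟨α, x, n⟩⟩

/-- Together with `IsAct.path_unique` this is the source of (KP4): an infinite path begins with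
exactly one path of degree `n`. -/
theorem IsAct.exists_left (z : LagPath k Λ) (n : Fin k → ℕ) :
    ∃ l y, l.deg k = n ∧ IsAct l y z := by
  obtain ⟨b, x, m⟩ := z
  obtain ⟨a, α, hα, hx⟩ := x.exists_degree n
  obtain ⟨y, rfl⟩ := x.exists_act_eq α hx
  refine ⟨⟨α⟩, ⟨a, y, m - fun i => (degree (k := k) α i : ℤ)⟩, hα, ?_⟩
  have := IsAct.mk α y (m - fun i => (degree (k := k) α i : ℤ))
  rwa [sub_add_cancel] at this

theorem IsAct.path_unique {l l' : Path Λ} {y y' z : LagPath k Λ} (h : IsAct l y z)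
    (h' : IsAct l' y' z) (hd : l.deg k = l'.deg k) : l = l' := by
  obtain ⟨α, x, n⟩ := h
  generalize hz : (⟨_, x.act α, n + _⟩ : LagPath k Λ) = z at h'
  obtain ⟨α', x', n'⟩ := h'
  simp only [Sigma.mk.injEq] at hz
  obtain ⟨rfl, hz⟩ := hz
  simp only [heq_eq_eq, Prod.mk.injEq] at hz
  have := (x.act α).sigma_eq (x.seg_act α) (by rw [hz.1]; exact x'.seg_act α') hd
  simp only [Sigma.mk.injEq] at this
  obtain ⟨rfl, h⟩ := this
  rw [eq_of_heq h]

theorem IsAct.comp {a b c : Λ} {ν : a ⟶ b} {μ : b ⟶ c} {x y z : LagPath k Λ}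
    (h : IsAct ⟨ν⟩ x y) (h' : IsAct ⟨μ⟩ y z) : IsAct ⟨ν ≫ μ⟩ x z := by
  cases h; cases h'
  rw [← InfPath.act_comp, add_assoc]
  convert IsAct.mk (ν ≫ μ) _ _ using 4
  ext i
  simp [degree_comp (k := k) ν μ, add_comm]

variable (R k Λ)

/-- The operators by which the generators act on the free module on the infinite paths with lag. -/
noncomputable def genOp : Gen k Λ → Module.End R (LagPath k Λ →₀ R)
  | .vertex a => relOp R fun y z => y = z ∧ y.1 = a
  | .path l _ => relOp R (IsAct l)
  | .ghost l _ => relOp R fun y z => IsAct l z y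

/-- The infinite path representation of the free algebra. -/
noncomputable def infPathRep : FreeAlg R k Λ →ₙₐ[R] Module.End R (LagPath k Λ →₀ R) :=
  MonoidAlgebra.liftMagma R (FreeSemigroup.lift (genOp R k Λ))

variable {Λ}

theorem infPathRep_of (g : Gen k Λ) : infPathRep R k Λ (FreeAlg.of R k g) = genOp R k Λ g := by
  simp [infPathRep, FreeAlg.of, MonoidAlgebra.liftMagma]

theorem infPathRep_p (a : Λ) (y : LagPath k Λ) (h : y.1 = a) :
    infPathRep R k Λ (FreeAlg.p R k a) (Finsupp.single y 1) = Finsupp.single y 1 := by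
  rw [FreeAlg.p, infPathRep_of, genOp]
  exact relOp_single (by rintro _ _ _ ⟨rfl, -⟩ ⟨rfl, -⟩; rfl) ⟨rfl, h⟩

theorem infPathRep_p_of_ne (a : Λ) (y : LagPath k Λ) (h : y.1 ≠ a) :
    infPathRep R k Λ (FreeAlg.p R k a) (Finsupp.single y 1) = 0 := by
  rw [FreeAlg.p, infPathRep_of, genOp]
  exact relOp_single_eq_zero (by rintro _ ⟨-, h'⟩; exact h h')

theorem infPathRep_s {l : Path Λ} {y z : LagPath k Λ} (h : IsAct l y z) :
    infPathRep R k Λ (FreeAlg.s R k l) (Finsupp.single y 1) = Finsupp.single z 1 := by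
  by_cases hl : l.deg k = 0
  · rw [FreeAlg.s, dif_pos hl]
    obtain ⟨α, x, n⟩ := h
    have := sigma_eq_id_of_degree_eq_zero k α hl
    simp only [Sigma.mk.injEq] at this
    obtain ⟨rfl, h⟩ := this
    rename_i b
    rw [eq_of_heq h, infPathRep_p _ _ b ⟨b, x, n⟩ rfl, InfPath.act_id, degree_id]
    congr
    ext i
    simp
  · rw [FreeAlg.s, dif_neg hl, infPathRep_of, genOp]
    exact relOp_single (IsAct.right_unique l) h

theorem infPathRep_s_of_ne {l : Path Λ} {y : LagPath k Λ} (hl : l.deg k ≠ 0)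
    (h : y.1 ≠ l.source) :
    infPathRep R k Λ (FreeAlg.s R k l) (Finsupp.single y 1) = 0 := by
  rw [FreeAlg.s, dif_neg hl, infPathRep_of, genOp]
  exact relOp_single_eq_zero fun z hz => h hz.source_eq

theorem infPathRep_sStar {l : Path Λ} (hl : l.deg k ≠ 0) {y z : LagPath k Λ} (h : IsAct l y z) :
    infPathRep R k Λ (FreeAlg.sStar R k l) (Finsupp.single z 1) = Finsupp.single y 1 := by
  rw [FreeAlg.sStar, dif_neg hl, infPathRep_of, genOp]
  exact relOp_single (IsAct.left_unique l) h

theorem infPathRep_sStar_of_not {l : Path Λ} (hl : l.deg k ≠ 0) {z : LagPath k Λ}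
    (h : ∀ y, ¬ IsAct l y z) :
    infPathRep R k Λ (FreeAlg.sStar R k l) (Finsupp.single z 1) = 0 := by
  rw [FreeAlg.sStar, dif_neg hl, infPathRep_of, genOp]
  exact relOp_single_eq_zero h

/-- Checked on basis vectors. For (KP3), paths of equal degree that begin the same infinite path
coincide; for (KP4), exactly one summand survives, the one given by the initial segment of degree
`n`. -/
theorem infPathRep_eq_of_rel {x y : FreeAlg R k Λ} (h : KPRel R k x y) :
    infPathRep R k Λ x = infPathRep R k Λ y := by
  have key : ∀ f g : Module.End R (LagPath k Λ →₀ R),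
      (∀ y, f (Finsupp.single y 1) = g (Finsupp.single y 1)) → f = g := by
    intro f g hfg
    refine Finsupp.lhom_ext' fun y => LinearMap.ext_ring ?_
    exact hfg y
  apply key
  intro y
  induction h with
  | idem a =>
    rw [map_mul, Module.End.mul_apply]
    by_cases hy : y.1 = a
    · simp only [infPathRep_p _ _ a y hy]
    · simp only [infPathRep_p_of_ne _ _ a y hy, map_zero]
  | orth a b hab =>
    rw [map_mul, Module.End.mul_apply, map_zero, LinearMap.zero_apply]
    by_cases hy : y.1 = b
    · rw [infPathRep_p _ _ b y hy, infPathRep_p_of_ne _ _ a y (by rw [hy]; exact hab.symm)]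
    · rw [infPathRep_p_of_ne _ _ b y hy, map_zero]
  | @mul a b c μ ν hμ hν =>
    have hμν : (⟨ν ≫ μ⟩ : Path Λ).deg k ≠ 0 := by
      simp only [Path.deg, degree_comp]
      exact fun h => hμ (add_eq_zero.1 h).1
    change (⟨μ⟩ : Path Λ).deg k ≠ 0 at hμ
    change (⟨ν⟩ : Path Λ).deg k ≠ 0 at hν
    rw [map_mul, Module.End.mul_apply]
    by_cases hy : y.1 = a
    · obtain ⟨z, hz⟩ := IsAct.exists_right ⟨ν⟩ y hy
      obtain ⟨t, ht⟩ := IsAct.exists_right ⟨μ⟩ z hz.range_eq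
      rw [infPathRep_s _ _ hz, infPathRep_s _ _ ht, infPathRep_s _ _ (hz.comp ht)]
    · rw [infPathRep_s_of_ne _ _ hν hy, infPathRep_s_of_ne _ _ hμν hy, map_zero]
  | @mul_star a b c μ ν hμ hν =>
    have hμν : (⟨ν ≫ μ⟩ : Path Λ).deg k ≠ 0 := by
      simp only [Path.deg, degree_comp]
      exact fun h => hμ (add_eq_zero.1 h).1
    change (⟨μ⟩ : Path Λ).deg k ≠ 0 at hμ
    change (⟨ν⟩ : Path Λ).deg k ≠ 0 at hν
    rw [map_mul, Module.End.mul_apply]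
    by_cases hy : ∃ x, IsAct ⟨ν ≫ μ⟩ x y
    · obtain ⟨x, hx⟩ := hy
      obtain ⟨z, hz⟩ := IsAct.exists_right ⟨ν⟩ x hx.source_eq
      obtain ⟨t, ht⟩ := IsAct.exists_right ⟨μ⟩ z hz.range_eq
      obtain rfl := IsAct.right_unique _ _ _ _ hx (hz.comp ht)
      rw [infPathRep_sStar _ _ hμν hx, infPathRep_sStar _ _ hμ ht, infPathRep_sStar _ _ hν hz]
    · push Not at hy
      rw [infPathRep_sStar_of_not _ _ hμν hy]
      by_cases h : ∃ z, IsAct ⟨μ⟩ z y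
      · obtain ⟨z, hz⟩ := h
        rw [infPathRep_sStar _ _ hμ hz, infPathRep_sStar_of_not _ _ hν]
        exact fun x hx => hy x (hx.comp hz)
      · push Not at h
        rw [infPathRep_sStar_of_not _ _ hμ h, map_zero]
  | range_mul l hl =>
    rw [map_mul, Module.End.mul_apply]
    by_cases hy : y.1 = l.source
    · obtain ⟨z, hz⟩ := IsAct.exists_right l y hy
      rw [infPathRep_s _ _ hz, infPathRep_p _ _ _ _ hz.range_eq]
    · rw [infPathRep_s_of_ne _ _ hl hy, map_zero]
  | mul_source l hl =>
    rw [map_mul, Module.End.mul_apply]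
    by_cases hy : y.1 = l.source
    · rw [infPathRep_p _ _ _ _ hy]
    · rw [infPathRep_s_of_ne _ _ hl hy, infPathRep_p_of_ne _ _ _ _ hy, map_zero]
  | source_mul l hl =>
    rw [map_mul, Module.End.mul_apply]
    by_cases hy : ∃ x, IsAct l x y
    · obtain ⟨x, hx⟩ := hy
      rw [infPathRep_sStar _ _ hl hx, infPathRep_p _ _ _ _ hx.source_eq]
    · push Not at hy
      rw [infPathRep_sStar_of_not _ _ hl hy, map_zero]
  | mul_range l hl =>
    rw [map_mul, Module.End.mul_apply]
    by_cases hy : y.1 = l.range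
    · rw [infPathRep_p _ _ _ _ hy]
    · rw [infPathRep_sStar_of_not _ _ hl fun x hx => hy hx.range_eq,
        infPathRep_p_of_ne _ _ _ _ hy, map_zero]
  | star_mul_self l hl =>
    rw [map_mul, Module.End.mul_apply]
    by_cases hy : y.1 = l.source
    · obtain ⟨z, hz⟩ := IsAct.exists_right l y hy
      rw [infPathRep_s _ _ hz, infPathRep_sStar _ _ hl hz, infPathRep_p _ _ _ _ hy]
    · rw [infPathRep_s_of_ne _ _ hl hy, infPathRep_p_of_ne _ _ _ _ hy, map_zero]
  | star_mul_of_ne l m hl hm hd hne =>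
    rw [map_mul, Module.End.mul_apply, map_zero, LinearMap.zero_apply]
    by_cases hy : y.1 = m.source
    · obtain ⟨z, hz⟩ := IsAct.exists_right m y hy
      rw [infPathRep_s _ _ hz, infPathRep_sStar_of_not _ _ hl]
      exact fun x hx => hne (hx.path_unique hz hd)
    · rw [infPathRep_s_of_ne _ _ hm hy, map_zero]
  | sum a n hn hfin =>
    have hl : ∀ l ∈ hfin.toFinset, l.deg k ≠ 0 := by
      intro l hl
      rw [Set.Finite.mem_toFinset] at hl
      rw [hl.2]
      exact hn
    rw [map_sum, LinearMap.sum_apply]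
    simp only [map_mul, Module.End.mul_apply]
    by_cases hy : y.1 = a
    · obtain ⟨l, x, hd, hx⟩ := IsAct.exists_left y n
      have hmem : l ∈ hfin.toFinset := by
        rw [Set.Finite.mem_toFinset]
        exact ⟨hx.range_eq.symm.trans hy, hd⟩
      rw [infPathRep_p _ _ _ _ hy, Finset.sum_eq_single_of_mem l hmem,
        infPathRep_sStar _ _ (hl l hmem) hx, infPathRep_s _ _ hx]
      intro m hm hne
      rw [infPathRep_sStar_of_not _ _ (hl m hm), map_zero]
      intro x' hx'
      rw [Set.Finite.mem_toFinset] at hm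
      exact hne (hx'.path_unique hx (hm.2.trans hd.symm))
    · rw [infPathRep_p_of_ne _ _ _ _ hy, eq_comm]
      refine Finset.sum_eq_zero fun m hm => ?_
      rw [infPathRep_sStar_of_not _ _ (hl m hm), map_zero]
      intro x hx
      rw [Set.Finite.mem_toFinset] at hm
      exact hy (hx.range_eq.trans hm.1)

/-- The kernel of the representation is one of the submodules whose infimum defines `kpIdeal`. -/
theorem infPathRep_eq_zero {x : FreeAlg R k Λ} (hx : x ∈ kpIdeal R k Λ) :
    infPathRep R k Λ x = 0 := by
  refine Submodule.mem_sInf.1 hx (LinearMap.ker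
    (infPathRep R k Λ : FreeAlg R k Λ →ₗ[R] Module.End R (LagPath k Λ →₀ R))) ⟨?_, ?_⟩
  · intro x y h
    simpa [sub_eq_zero] using infPathRep_eq_of_rel R k h
  · intro x y (hy : infPathRep R k Λ y = 0)
    constructor
    · change infPathRep R k Λ (x * y) = 0
      rw [map_mul, hy, mul_zero]
    · change infPathRep R k Λ (y * x) = 0
      rw [map_mul, hy, zero_mul]

/-- The elements `s_α`, for distinct paths `α` with a common source, are linearly independent. -/
theorem KumjianPask.linearIndependent_s (hns : NoSources k Λ) (a : Λ) :
    LinearIndependent R fun α : Σ b : Λ, a ⟶ b => KumjianPask.s R k α.2 := by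
  rw [linearIndependent_iff']
  intro t c h β hβ
  obtain ⟨x⟩ := InfPath.nonempty hns a
  have hmem : ∑ α ∈ t, c α • FreeAlg.s R k ⟨α.2⟩ ∈ kpIdeal R k Λ := by
    rw [← sub_zero (∑ α ∈ t, _), ← mk_eq_mk, map_sum, map_zero, ← h]
    exact Finset.sum_congr rfl fun α _ => map_smul _ _ _
  -- `s_α` sends the basis vector `(x, 0)` to the basis vector `(αx, d(α))`.
  let y : (Σ b : Λ, a ⟶ b) → LagPath k Λ :=
    fun α => ⟨α.1, x.act α.2, 0 + fun i => (degree (k := k) α.2 i : ℤ)⟩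
  have hy : ∀ α, IsAct ⟨α.2⟩ ⟨a, x, 0⟩ (y α) := fun α => IsAct.mk α.2 x 0
  -- The lag determines `d(α)`, and then `αx` determines `α`.
  have hinj : Function.Injective y := by
    rintro ⟨b, α⟩ ⟨b', α'⟩ he
    have hd : degree (k := k) α = degree (k := k) α' := by
      have : (y ⟨b, α⟩).2.2 = (y ⟨b', α'⟩).2.2 := by rw [he]
      ext i
      simpa [y] using congrFun this i
    have h1 := hy ⟨b', α'⟩
    rw [← he] at h1
    have := (hy ⟨b, α⟩).path_unique h1 hd
    cases this
    rfl
  have h0 := LinearMap.congr_fun (infPathRep_eq_zero R k hmem) (Finsupp.single ⟨a, x, 0⟩ 1)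
  simp only [map_sum, map_smul, LinearMap.sum_apply, LinearMap.smul_apply,
    infPathRep_s R k (hy _), LinearMap.zero_apply] at h0
  have h1 := DFunLike.congr_fun h0 (y β)
  rw [Finsupp.finsetSum_apply, Finset.sum_eq_single_of_mem β hβ] at h1
  · simpa using h1
  · intro α _ hne
    simp [hinj.ne hne]

end Representation

/-! ### The Kumjian-Pask relations for paths of arbitrary degree -/

namespace KumjianPask

variable {R : Type w} [CommRing R] {k : ℕ} {Λ : Type u} [Category.{v} Λ] [KGraph k Λ]

theorem mk_eq_of_rel {x y : FreeAlg R k Λ} (h : KPRel R k x y) : mk R k x = mk R k y := by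
  rw [mk_eq_mk]
  exact Submodule.mem_sInf.2 fun J hJ => hJ.1 _ _ h

theorem s_id (a : Λ) : s R k (𝟙 a) = p R k a := by
  rw [s, FreeAlg.s, dif_pos (show (⟨𝟙 a⟩ : Path Λ).deg k = 0 from degree_id a)]
  rfl

theorem sStar_id (a : Λ) : sStar R k (𝟙 a) = p R k a := by
  rw [sStar, FreeAlg.sStar, dif_pos (show (⟨𝟙 a⟩ : Path Λ).deg k = 0 from degree_id a)]
  rfl

/-- A path of degree zero can be replaced by a vertex. -/
theorem degree_zero_rec {motive : ∀ {a b : Λ}, (a ⟶ b) → Prop} (id : ∀ a, motive (𝟙 a))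
    {a b : Λ} (f : a ⟶ b) (hf : degree (k := k) f = 0) : motive f := by
  have := sigma_eq_id_of_degree_eq_zero k f hf
  simp only [Sigma.mk.injEq] at this
  obtain ⟨rfl, h⟩ := this
  rw [eq_of_heq h]
  exact id _

theorem p_mul_p (a : Λ) : p R k a * p R k a = p R k a := mk_eq_of_rel (.idem a)

theorem p_mul_p_of_ne {a b : Λ} (h : a ≠ b) : p R k a * p R k b = 0 :=
  (mk_eq_of_rel (.orth a b h)).trans (map_zero _)

theorem p_mul_s {a b : Λ} (α : a ⟶ b) : p R k b * s R k α = s R k α := by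
  by_cases h : degree (k := k) α = 0
  · refine degree_zero_rec (motive := fun {a b} α => p R k b * s R k α = s R k α) ?_ α h
    intro a
    rw [s_id, p_mul_p]
  · exact mk_eq_of_rel (.range_mul ⟨α⟩ h)

theorem s_mul_p {a b : Λ} (α : a ⟶ b) : s R k α * p R k a = s R k α := by
  by_cases h : degree (k := k) α = 0
  · refine degree_zero_rec (motive := fun {a b} α => s R k α * p R k a = s R k α) ?_ α h
    intro a
    rw [s_id, p_mul_p]
  · exact mk_eq_of_rel (.mul_source ⟨α⟩ h)

theorem p_mul_sStar {a b : Λ} (α : a ⟶ b) : p R k a * sStar R k α = sStar R k α := by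
  by_cases h : degree (k := k) α = 0
  · refine degree_zero_rec (motive := fun {a b} α => p R k a * sStar R k α = sStar R k α) ?_ α h
    intro a
    rw [sStar_id, p_mul_p]
  · exact mk_eq_of_rel (.source_mul ⟨α⟩ h)

theorem sStar_mul_p {a b : Λ} (α : a ⟶ b) : sStar R k α * p R k b = sStar R k α := by
  by_cases h : degree (k := k) α = 0
  · refine degree_zero_rec (motive := fun {a b} α => sStar R k α * p R k b = sStar R k α) ?_ α h
    intro a
    rw [sStar_id, p_mul_p]
  · exact mk_eq_of_rel (.mul_range ⟨α⟩ h)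

theorem s_mul_s {a b c : Λ} (ν : a ⟶ b) (μ : b ⟶ c) :
    s R k μ * s R k ν = s R k (ν ≫ μ) := by
  by_cases hμ : degree (k := k) μ = 0
  · refine degree_zero_rec (motive := fun {b c} μ => ∀ ν : a ⟶ b,
      s R k μ * s R k ν = s R k (ν ≫ μ)) ?_ μ hμ ν
    intro b ν
    rw [s_id, p_mul_s, Category.comp_id]
  by_cases hν : degree (k := k) ν = 0
  · refine degree_zero_rec (motive := fun {a b} ν => ∀ μ : b ⟶ c,
      s R k μ * s R k ν = s R k (ν ≫ μ)) ?_ ν hν μ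
    intro b ν
    rw [s_id, s_mul_p, Category.id_comp]
  exact mk_eq_of_rel (.mul μ ν hμ hν)

theorem sStar_mul_sStar {a b c : Λ} (ν : a ⟶ b) (μ : b ⟶ c) :
    sStar R k ν * sStar R k μ = sStar R k (ν ≫ μ) := by
  by_cases hμ : degree (k := k) μ = 0
  · refine degree_zero_rec (motive := fun {b c} μ => ∀ ν : a ⟶ b,
      sStar R k ν * sStar R k μ = sStar R k (ν ≫ μ)) ?_ μ hμ ν
    intro b ν
    rw [sStar_id, sStar_mul_p, Category.comp_id]
  by_cases hν : degree (k := k) ν = 0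
  · refine degree_zero_rec (motive := fun {a b} ν => ∀ μ : b ⟶ c,
      sStar R k ν * sStar R k μ = sStar R k (ν ≫ μ)) ?_ ν hν μ
    intro b ν
    rw [sStar_id, p_mul_sStar, Category.id_comp]
  exact mk_eq_of_rel (.mul_star μ ν hμ hν)

theorem sStar_mul_s {a b : Λ} (α : a ⟶ b) : sStar R k α * s R k α = p R k a := by
  by_cases h : degree (k := k) α = 0
  · refine degree_zero_rec (motive := fun {a b} α => sStar R k α * s R k α = p R k a) ?_ α h
    intro a
    rw [sStar_id, s_id, p_mul_p]
  · exact mk_eq_of_rel (.star_mul_self ⟨α⟩ h)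

theorem s_mul_s_of_ne {a b c d : Λ} (α : a ⟶ b) (β : c ⟶ d) (h : a ≠ d) :
    s R k α * s R k β = 0 := by
  rw [← s_mul_p α, ← p_mul_s β, mul_assoc, ← mul_assoc (p R k a), p_mul_p_of_ne h, zero_mul,
    mul_zero]

theorem sStar_mul_s_of_range_ne {a b c d : Λ} (α : a ⟶ b) (β : c ⟶ d) (h : b ≠ d) :
    sStar R k α * s R k β = 0 := by
  rw [← sStar_mul_p α, ← p_mul_s β, mul_assoc, ← mul_assoc (p R k b), p_mul_p_of_ne h, zero_mul,
    mul_zero]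

theorem path_eq_of_sStar_mul_s_ne_zero {a b c d : Λ} {α : a ⟶ b} {β : c ⟶ d}
    (hd : degree (k := k) α = degree (k := k) β) (h : sStar R k α * s R k β ≠ 0) :
    (⟨α⟩ : Path Λ) = ⟨β⟩ := by
  by_contra hne
  by_cases hα : degree (k := k) α = 0
  · have hβ := sigma_eq_id_of_degree_eq_zero k β (hd ▸ hα)
    have hα := sigma_eq_id_of_degree_eq_zero k α hα
    simp only [Sigma.mk.injEq] at hα hβ
    obtain ⟨rfl, hα⟩ := hα
    obtain ⟨rfl, hβ⟩ := hβ
    obtain rfl := eq_of_heq hα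
    obtain rfl := eq_of_heq hβ
    apply h
    refine sStar_mul_s_of_range_ne _ _ ?_
    rintro rfl
    exact hne rfl
  · exact h ((mk_eq_of_rel (.star_mul_of_ne ⟨α⟩ ⟨β⟩ hα (fun h' => hα (hd.trans h')) hd hne)).trans
      (map_zero _))

theorem exists_p_eq_sum (hrow : RowFinite k Λ) (a : Λ) (n : Fin k → ℕ) :
    ∃ D : Finset (Σ c : Λ, c ⟶ a), (∀ δ ∈ D, degree (k := k) δ.2 = n) ∧
      p R k a = ∑ δ ∈ D, s R k δ.2 * sStar R k δ.2 := by
  by_cases hn : n = 0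
  · refine ⟨{⟨a, 𝟙 a⟩}, ?_, ?_⟩
    · simp [hn, degree_id]
    · simp [s_id, sStar_id, p_mul_p]
  · have hinj : Function.Injective fun δ : Σ c : Λ, c ⟶ a => (⟨δ.2⟩ : Path Λ) := by
      rintro ⟨c, δ⟩ ⟨c', δ'⟩ h
      cases h
      rfl
    refine ⟨(hrow a n).toFinset.preimage _ hinj.injOn, ?_, ?_⟩
    · intro δ hδ
      rw [Finset.mem_preimage, Set.Finite.mem_toFinset] at hδ
      exact hδ.2
    · have h := mk_eq_of_rel (.sum (R := R) a n hn (hrow a n))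
      rw [map_sum] at h
      refine h.trans ?_
      symm
      refine Finset.sum_preimage _ _ hinj.injOn
        (fun l : Path Λ => mk R k (FreeAlg.s R k l * FreeAlg.sStar R k l)) ?_
      rintro ⟨l⟩ hl hl'
      rw [Set.Finite.mem_toFinset] at hl
      obtain ⟨rfl, -⟩ := hl
      exact absurd ⟨⟨_, l⟩, rfl⟩ hl'

/-! ### Removing ghost paths by right multiplication -/

theorem induction_on {motive : KumjianPask R k Λ → Prop} (x : KumjianPask R k Λ)
    (zero : motive 0) (add : ∀ x y, motive x → motive y → motive (x + y))
    (smul : ∀ (r : R) (x), motive x → motive (r • x))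
    (mul : ∀ x y, motive x → motive y → motive (x * y))
    (s : ∀ {a b : Λ} (α : a ⟶ b), motive (s R k α))
    (sStar : ∀ {a b : Λ} (α : a ⟶ b), motive (sStar R k α)) : motive x := by
  obtain ⟨x, rfl⟩ := mk_surjective R k x
  induction x using MonoidAlgebra.induction_linear with
  | zero => simpa using zero
  | add x y hx hy => simpa using add _ _ hx hy
  | single m r =>
    have h : MonoidAlgebra.single m r = r • MonoidAlgebra.single m (1 : R) := by simp
    rw [h, map_smul]
    apply smul
    induction m using FreeSemigroup.recOnMul with
    | ih1 g =>
      cases g with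
      | vertex a => rw [← FreeAlg.of.eq_1, ← FreeAlg.p, ← KumjianPask.p, ← s_id]; exact s _
      | path l hl =>
        have := s l.hom
        rw [KumjianPask.s, FreeAlg.s, dif_neg hl] at this
        exact this
      | ghost l hl =>
        have := sStar l.hom
        rw [KumjianPask.sStar, FreeAlg.sStar, dif_neg hl] at this
        exact this
    | ih2 g m hg hm =>
      have h : MonoidAlgebra.single (FreeSemigroup.of g * m) (1 : R) =
          MonoidAlgebra.single (FreeSemigroup.of g) 1 * MonoidAlgebra.single m 1 := by simp
      rw [h, mk_mul]
      exact mul _ _ (hg (by simp)) (hm (by simp))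

/-- Multiplication by `s_β` turns any element into a linear combination of elements `s_α`, if
the degree of `β` is large. -/
theorem exists_mul_s_mem_span (x : KumjianPask R k Λ) :
    ∀ M : Fin k → ℕ, ∃ N : Fin k → ℕ, ∀ {a b : Λ} (β : a ⟶ b), N ≤ degree (k := k) β →
      x * s R k β ∈ Submodule.span R
        {z | ∃ (c : Λ) (α : a ⟶ c), M ≤ degree (k := k) α ∧ z = s R k α} := by
  induction x using induction_on with
  | zero =>
    intro M
    refine ⟨0, fun β _ => ?_⟩
    rw [zero_mul]
    exact zero_mem _
  | add x y hx hy =>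
    intro M
    obtain ⟨N, hN⟩ := hx M
    obtain ⟨N', hN'⟩ := hy M
    refine ⟨N ⊔ N', fun β hβ => ?_⟩
    rw [add_mul]
    exact add_mem (hN β (le_sup_left.trans hβ)) (hN' β (le_sup_right.trans hβ))
  | smul r x hx =>
    intro M
    obtain ⟨N, hN⟩ := hx M
    refine ⟨N, fun β hβ => ?_⟩
    rw [smul_mul_assoc]
    exact Submodule.smul_mem _ _ (hN β hβ)
  | mul x y hx hy =>
    intro M
    obtain ⟨N, hN⟩ := hx M
    -- The degree that `x` requires is demanded of the paths occurring in `y s_β`; this is why the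
    -- claim is made for every `M`.
    obtain ⟨N', hN'⟩ := hy N
    refine ⟨N', fun {a b} β hβ => ?_⟩
    rw [mul_assoc]
    refine Submodule.span_induction (p := fun z _ => x * z ∈ Submodule.span R
        {z | ∃ (c : Λ) (α : a ⟶ c), M ≤ degree (k := k) α ∧ z = s R k α}) ?_ ?_ ?_ ?_ (hN' β hβ)
    · rintro _ ⟨c, α, hα, rfl⟩
      exact hN α hα
    · rw [mul_zero]
      exact zero_mem _
    · intro _ _ _ _ h h'
      rw [mul_add]
      exact add_mem h h'
    · intro r _ _ h
      rw [mul_smul_comm]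
      exact Submodule.smul_mem _ _ h
  | @s c d α =>
    intro M
    refine ⟨M, fun {a b} β hβ => ?_⟩
    by_cases h : c = b
    · subst h
      refine Submodule.subset_span ⟨d, β ≫ α, ?_, s_mul_s β α⟩
      rw [degree_comp]
      exact hβ.trans le_add_self
    · rw [s_mul_s_of_ne _ _ h]
      exact zero_mem _
  | @sStar c d α =>
    intro M
    refine ⟨degree (k := k) α + M, fun {a b} β hβ => ?_⟩
    -- The ghost `s_{α^*}` either kills `s_β` or removes an initial segment `α` of `β`, leaving
    -- degree at least `M`.
    obtain ⟨e, ν, μ, hμ, rfl⟩ := exists_comp_eq k β (le_self_add.trans hβ)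
    rw [← s_mul_s, ← mul_assoc]
    by_cases h : sStar R k α * s R k μ = 0
    · rw [h, zero_mul]
      exact zero_mem _
    · have := path_eq_of_sStar_mul_s_ne_zero hμ.symm h
      cases this
      rw [sStar_mul_s, p_mul_s]
      refine Submodule.subset_span ⟨_, ν, ?_, rfl⟩
      rw [degree_comp] at hβ
      exact le_of_add_le_add_left hβ

/-- Finite sums of the `p_a` are local units. -/
theorem exists_mul_sum_p_eq (x : KumjianPask R k Λ) :
    ∃ F : Finset Λ, ∀ F', F ⊆ F' → x * ∑ a ∈ F', p R k a = x := by
  classical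
  have hp : ∀ (x : KumjianPask R k Λ) (a : Λ), x * p R k a = x →
      ∃ F : Finset Λ, ∀ F', F ⊆ F' → x * ∑ a ∈ F', p R k a = x := by
    intro x a hx
    refine ⟨{a}, fun F' hF => ?_⟩
    rw [Finset.mul_sum, Finset.sum_eq_single_of_mem a (hF (by simp)), hx]
    intro b _ hb
    rw [← hx, mul_assoc, p_mul_p_of_ne hb.symm, mul_zero]
  induction x using induction_on with
  | zero => exact ⟨∅, fun F' _ => zero_mul _⟩
  | add x y hx hy =>
    obtain ⟨F, hF⟩ := hx
    obtain ⟨G, hG⟩ := hy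
    refine ⟨F ∪ G, fun F' h => ?_⟩
    rw [add_mul, hF F' (Finset.union_subset_left h), hG F' (Finset.union_subset_right h)]
  | smul r x hx =>
    obtain ⟨F, hF⟩ := hx
    exact ⟨F, fun F' h => by rw [smul_mul_assoc, hF F' h]⟩
  | mul x y _ hy =>
    obtain ⟨F, hF⟩ := hy
    exact ⟨F, fun F' h => by rw [mul_assoc, hF F' h]⟩
  | s α => exact hp _ _ (s_mul_p α)
  | sStar α => exact hp _ _ (sStar_mul_p α)

/-- By local units and (KP4), `x` is a finite sum of terms `x s_δ s_{δ^*}` with `d(δ) = n`. -/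
theorem exists_mul_s_ne_zero (hrow : RowFinite k Λ) {x : KumjianPask R k Λ} (hx : x ≠ 0)
    (n : Fin k → ℕ) : ∃ (a b : Λ) (β : a ⟶ b), degree (k := k) β = n ∧ x * s R k β ≠ 0 := by
  by_contra! h
  obtain ⟨F, hF⟩ := exists_mul_sum_p_eq x
  apply hx
  rw [← hF F subset_rfl, Finset.mul_sum]
  refine Finset.sum_eq_zero fun a _ => ?_
  obtain ⟨D, hD, ha⟩ := exists_p_eq_sum (R := R) hrow a n
  rw [ha, Finset.mul_sum]
  refine Finset.sum_eq_zero fun δ hδ => ?_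
  rw [← mul_assoc, h _ _ _ (hD δ hδ), zero_mul]

/-! ### Cycline pairs from nonvanishing products -/

theorem p_mul_eq_p_mul (hrow : RowFinite k Λ) {e : Λ} (n : Fin k → ℕ) {x y : KumjianPask R k Λ}
    (h : ∀ (f : Λ) (δ : f ⟶ e), degree (k := k) δ = n → sStar R k δ * x = sStar R k δ * y) :
    p R k e * x = p R k e * y := by
  obtain ⟨D, hD, hp⟩ := exists_p_eq_sum (R := R) hrow e n
  rw [hp, Finset.sum_mul, Finset.sum_mul]
  refine Finset.sum_congr rfl fun δ hδ => ?_
  rw [mul_assoc, h _ _ (hD δ hδ), mul_assoc]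

theorem mul_p_eq_mul_p (hrow : RowFinite k Λ) {e : Λ} (n : Fin k → ℕ) {x y : KumjianPask R k Λ}
    (h : ∀ (f : Λ) (δ : f ⟶ e), degree (k := k) δ = n → x * s R k δ = y * s R k δ) :
    x * p R k e = y * p R k e := by
  obtain ⟨D, hD, hp⟩ := exists_p_eq_sum (R := R) hrow e n
  rw [hp, Finset.mul_sum, Finset.mul_sum]
  refine Finset.sum_congr rfl fun δ hδ => ?_
  rw [← mul_assoc, h _ _ (hD δ hδ), mul_assoc]

/-- Let `P` and `Q` be the range projections of `αγ` and `βγ`. Nonvanishing after every prolongation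
forces each sufficiently long prolongation of `βγ` to begin with `αγ`, whence `QP = Q`; the mirror
argument gives `QP = P`. -/
theorem isCycline_of_forall_ne_zero (hrow : RowFinite k Λ) {a b c : Λ} (α : a ⟶ b) (β : a ⟶ c)
    (h : ∀ (e : Λ) (γ : e ⟶ a), sStar R k (γ ≫ α) * s R k (γ ≫ β) ≠ 0) :
    IsCycline R k α β := by
  intro e γ
  have h1 : p R k e * (sStar R k (γ ≫ β) * (s R k (γ ≫ α) * sStar R k (γ ≫ α))) =
      p R k e * sStar R k (γ ≫ β) := by
    refine p_mul_eq_p_mul hrow (degree (k := k) α) fun f δ hδ => ?_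
    -- Since `d(δ) = d(α)`, the path `βγδ` is long enough to have an initial segment `ε` of degree
    -- `d(αγ)`. Nonvanishing will force `ε = αγ`.
    obtain ⟨g, ν, ε, hε, hνε⟩ := exists_comp_eq k (δ ≫ γ ≫ β)
      (m := degree (k := k) (γ ≫ α)) (by
        rw [degree_comp, degree_comp, degree_comp, hδ]
        intro i
        simp only [Pi.add_apply]
        omega)
    have hne := h f (δ ≫ γ)
    rw [Category.assoc, Category.assoc, ← hνε, ← sStar_mul_sStar δ, ← s_mul_s ν, mul_assoc,
      ← mul_assoc (sStar R k (γ ≫ α))] at hne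
    have h0 : sStar R k (γ ≫ α) * s R k ε ≠ 0 := by
      intro h0
      rw [h0, zero_mul, mul_zero] at hne
      exact hne rfl
    have := path_eq_of_sStar_mul_s_ne_zero hε.symm h0
    cases this
    rw [← mul_assoc, sStar_mul_sStar, ← hνε, ← sStar_mul_sStar, mul_assoc,
      ← mul_assoc (sStar R k (γ ≫ α)), sStar_mul_s, p_mul_sStar]
  have h2 : s R k (γ ≫ β) * sStar R k (γ ≫ β) * s R k (γ ≫ α) * p R k e =
      s R k (γ ≫ α) * p R k e := by
    refine mul_p_eq_mul_p hrow (degree (k := k) β) fun f δ hδ => ?_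
    obtain ⟨g, ν, ε, hε, hνε⟩ := exists_comp_eq k (δ ≫ γ ≫ α)
      (m := degree (k := k) (γ ≫ β)) (by
        rw [degree_comp, degree_comp, degree_comp, hδ]
        intro i
        simp only [Pi.add_apply]
        omega)
    have hne := h f (δ ≫ γ)
    rw [Category.assoc, Category.assoc, ← hνε, ← sStar_mul_sStar ν, ← s_mul_s δ, mul_assoc,
      ← mul_assoc (sStar R k ε)] at hne
    have h0 : sStar R k ε * s R k (γ ≫ β) ≠ 0 := by
      intro h0
      rw [h0, zero_mul, mul_zero] at hne
      exact hne rfl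
    have := path_eq_of_sStar_mul_s_ne_zero hε h0
    cases this
    rw [mul_assoc, s_mul_s, ← hνε, ← s_mul_s ν, mul_assoc,
      ← mul_assoc (sStar R k (γ ≫ β)),
      sStar_mul_s, p_mul_s]
  rw [mul_assoc _ _ (p R k e), s_mul_p, mul_assoc] at h2
  rw [← mul_assoc (p R k e), p_mul_sStar] at h1
  calc _ = s R k (γ ≫ β) * (sStar R k (γ ≫ β) * s R k (γ ≫ α)) * sStar R k (γ ≫ α) := by rw [h2]
    _ = _ := by rw [mul_assoc, mul_assoc (sStar R k (γ ≫ β)), h1]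

theorem IsCycline.symm {a b c : Λ} {α : a ⟶ b} {β : a ⟶ c} (h : IsCycline R k α β) :
    IsCycline R k β α := fun e γ => (h e γ).symm

theorem IsCycline.comp_left {a b c d : Λ} {α : a ⟶ b} {β : a ⟶ c} (h : IsCycline R k α β)
    (γ : d ⟶ a) : IsCycline R k (γ ≫ α) (γ ≫ β) := fun e ε => by
  simpa using h e (ε ≫ γ)

/-- Induction on `t`: either some prolongation kills the product for the new `β`, or none does and
the pair is already cycline. Both alternatives persist under further prolongation, so earlier
choices are not spoiled. -/
theorem exists_forall_eq_zero_or_isCycline (R : Type w) [CommRing R] (hrow : RowFinite k Λ)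
    {a b : Λ} (α : a ⟶ b) (t : Finset (Σ c : Λ, a ⟶ c)) :
    ∃ (e : Λ) (γ : e ⟶ a), ∀ β ∈ t,
      sStar R k (γ ≫ α) * s R k (γ ≫ β.2) = 0 ∨ IsCycline R k (γ ≫ α) (γ ≫ β.2) := by
  classical
  induction t using Finset.induction_on with
  | empty => exact ⟨a, 𝟙 a, by simp⟩
  | insert β t _ ih =>
    obtain ⟨e, γ, hγ⟩ := ih
    by_cases h : ∀ (f : Λ) (δ : f ⟶ e),
        sStar R k (δ ≫ γ ≫ α) * s R k (δ ≫ γ ≫ β.2) ≠ 0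
    · refine ⟨e, γ, fun β' hβ' => ?_⟩
      obtain rfl | hβ' := Finset.mem_insert.1 hβ'
      · exact .inr (isCycline_of_forall_ne_zero hrow _ _ h)
      · exact hγ β' hβ'
    · push Not at h
      obtain ⟨f, δ, h⟩ := h
      refine ⟨f, δ ≫ γ, fun β' hβ' => ?_⟩
      rw [Category.assoc, Category.assoc]
      obtain rfl | hβ' := Finset.mem_insert.1 hβ'
      · exact .inl h
      · refine (hγ β' hβ').imp (fun h' => ?_) fun h' => h'.comp_left δ
        rw [← sStar_mul_sStar, ← s_mul_s, mul_assoc, ← mul_assoc (sStar R k (γ ≫ α)), h',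
          zero_mul, mul_zero]

/-! ### Compression into the cycline subalgebra -/

/-- Every nonzero element can be brought into the cycline subalgebra by multiplications from both
sides, without making it zero. -/
theorem exists_mul_mem_cyclineSubalgebra (hrow : RowFinite k Λ) (hns : NoSources k Λ)
    {x : KumjianPask R k Λ} (hx : x ≠ 0) :
    ∃ y z : KumjianPask R k Λ, y * x * z ∈ cyclineSubalgebra R k Λ ∧ y * x * z ≠ 0 := by
  classical
  obtain ⟨N, hN⟩ := exists_mul_s_mem_span x 0
  obtain ⟨a, b, β, hβ, hne⟩ := exists_mul_s_ne_zero hrow hx N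
  have hspan : x * s R k β ∈
      Submodule.span R (Set.range fun α : Σ c : Λ, a ⟶ c => s R k α.2) := by
    refine Submodule.span_mono ?_ (hN β hβ.ge)
    rintro _ ⟨c, α, -, rfl⟩
    exact ⟨⟨c, α⟩, rfl⟩
  obtain ⟨r, hr⟩ := Finsupp.mem_span_range_iff_exists_finsupp.1 hspan
  have hr0 : r ≠ 0 := by
    rintro rfl
    rw [Finsupp.sum_zero_index] at hr
    exact hne hr.symm
  obtain ⟨α, hα⟩ := Finsupp.support_nonempty_iff.2 hr0
  obtain ⟨e, γ, hγ⟩ := exists_forall_eq_zero_or_isCycline R hrow α.2 r.support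
  have hw : s R k (γ ≫ α.2) * sStar R k (γ ≫ α.2) * x *
      (s R k β * (s R k γ * sStar R k (γ ≫ α.2))) =
      ∑ κ ∈ r.support with IsCycline R k (γ ≫ α.2) (γ ≫ κ.2),
        r κ • (s R k (γ ≫ κ.2) * sStar R k (γ ≫ α.2)) := by
    rw [mul_assoc, ← mul_assoc x, ← hr, Finsupp.sum, Finset.sum_mul, Finset.mul_sum,
      Finset.sum_filter]
    refine Finset.sum_congr rfl fun κ hκ => ?_
    rw [smul_mul_assoc, mul_smul_comm, ← mul_assoc (s R k κ.2), s_mul_s]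
    split_ifs with h
    -- For a cycline pair the range projection of `αγ` equals that of `κγ`, so it fixes `s_{κγ}`.
    · have := h e (𝟙 e)
      rw [Category.id_comp, Category.id_comp] at this
      rw [this, mul_assoc, ← mul_assoc (sStar R k (γ ≫ κ.2)), sStar_mul_s, p_mul_sStar]
    · rw [mul_assoc, ← mul_assoc (sStar R k (γ ≫ α.2)), (hγ κ hκ).resolve_right h, zero_mul,
        mul_zero, smul_zero]
  refine ⟨s R k (γ ≫ α.2) * sStar R k (γ ≫ α.2),
    s R k β * (s R k γ * sStar R k (γ ≫ α.2)), ?_, fun h0 => ?_⟩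
  · rw [hw]
    refine sum_mem fun κ hκ => SMulMemClass.smul_mem _ (NonUnitalAlgebra.subset_adjoin R ?_)
    exact ⟨_, _, _, _, _, (Finset.mem_filter.1 hκ).2.symm, rfl⟩
  · rw [hw] at h0
    -- Right multiplication by `s_{αγ}` strips off `s_{(αγ)^*}`, leaving a relation among the
    -- `s_{κγ}`, which are distinct by cancellation.
    have h1 := congrArg (· * s R k (γ ≫ α.2)) h0
    simp only [Finset.sum_mul, smul_mul_assoc, mul_assoc, sStar_mul_s, s_mul_p, zero_mul] at h1
    have hinj : Function.Injective fun κ : Σ c : Λ, a ⟶ c => (⟨κ.1, γ ≫ κ.2⟩ : Σ c : Λ, e ⟶ c) := by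
      rintro ⟨c, κ⟩ ⟨c', κ'⟩ h
      simp only [Sigma.mk.injEq] at h
      obtain ⟨rfl, h⟩ := h
      rw [comp_left_cancel k (eq_of_heq h)]
    refine Finsupp.mem_support_iff.1 hα (linearIndependent_iff'.1
      ((linearIndependent_s R k hns e).comp _ hinj) _ r h1 α ?_)
    -- The index `α` survives the filter, since `(αγ, αγ)` is trivially cycline.
    exact Finset.mem_filter.2 ⟨hα, fun _ _ => rfl⟩

end KumjianPask

end KGraph

theorem theorem5p3 {k : ℕ} (hk : 0 < k) {Λ : Type u} [Category.{v} Λ] [KGraph k Λ]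
    (hrow : KGraph.RowFinite k Λ) (hns : KGraph.NoSources k Λ)
    {R : Type w} [CommRing R] {A : Type*} [NonUnitalRing A]
    (Φ : KGraph.KumjianPask R k Λ →ₙ+* A) :
    Function.Injective Φ ↔
      Function.Injective (fun x : KGraph.KumjianPask.cyclineSubalgebra R k Λ => Φ x) := by
  refine ⟨fun h => h.comp Subtype.val_injective, fun h => ?_⟩
  rw [injective_iff_map_eq_zero]
  intro x hx
  by_contra hne
  obtain ⟨y, z, hmem, h0⟩ := KGraph.KumjianPask.exists_mul_mem_cyclineSubalgebra hrow hns hne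
  -- `Φ(x) = 0` gives `Φ(yxz) = 0` by multiplicativity alone, so `R`-linearity is not needed.
  refine h0 (congrArg Subtype.val (@h ⟨y * x * z, hmem⟩ 0 ?_))
  simp [hx]
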